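/- Let $n\ge 0$ be an integer, let $\mathbb F_q$ be a finite field, and fix a non-trivial homomorphism $\theta$ from the additive group of $\mathbb F_q$ to $\mathbb C^\times$. Let $U$ be the group of upper triangular unipotent $n\times n$ matrices over $\mathbb F_q$, let $\mathfrak u$ be the space of upper triangular nilpotent $n\times n$ matrices over $\mathbb F_q$, and let $\mathfrak u^*$ be its dual space. For $\lambda\in\mathfrak u^*$ and $g\in U$ put $(g*\lambda)(X)=\lambda(Xg)$ and $(\lambda*g)(X)=\lambda(gX)$. The coadjoint cluster of $\lambda$ is $\Psi(\lambda)=\{g*\lambda*g' : g,g'\in U\}$. The conjugacy cluster of $g\in U$ is the set of all $h\in U$ with $h-I\in\{a(g-I)a' : a,a'\in U\}$. A cluster function is a function $U\to\mathbb C$ that is constant on each conjugacy cluster. Let $U$ act on the space of functions $f:U\to\mathbb C$ by $(g*f)(h)=f(hg)$. For $\lambda\in\mathfrak u^*$ let $v(\lambda):U\to\mathbb C$ be the function $g\mapsto\theta(\lambda(g-I))$. The span $V(\lambda)$ of $\{v(g*\lambda):g\in U\}$ is stable under this action; the cluster character $\chi(\lambda)$ is the character of $U$ on $V(\lambda)$.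 Then the character $\chi(\lambda)$ depends only on the coadjoint cluster $\Psi=\Psi(\lambda)$, so that one may write $\chi(\Psi)=\chi(\lambda)$, and the family $(\chi(\Psi))_\Psi$, indexed by the coadjoint clusters $\Psi$ in $\mathfrak u^*$, is a basis of the $\mathbb C$-linear space of cluster functions on $U$, orthogonal for the inner product $\langle f,f'\rangle=\frac1{|U|}\sum_{g\in U}f(g)\overline{f'(g)}$: one has $\langle\chi(\Psi),\chi(\Psi')\rangle=0$ whenever $\Psi\ne\Psi'$. -/

import Mathlib

noncomputable section

namespace Cluster

open Matrix

/-- The group `U(n, K)` of upper triangular unipotent `n × n` matrices over `K`. -/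
def U (n : ℕ) (K : Type*) [Field K] : Subgroup (GL (Fin n) K) where
  carrier := {g | (∀ i j, j < i → g.val i j = 0) ∧ ∀ i, g.val i i = 1}
  one_mem' := by
    refine ⟨fun i j h => ?_, fun i => ?_⟩
    · simp [Matrix.one_apply, h.ne']
    · simp
  mul_mem' := by
    rintro a b ⟨ha, ha'⟩ ⟨hb, hb'⟩
    refine ⟨fun i j hij => ?_, fun i => ?_⟩
    · rw [Units.val_mul, Matrix.mul_apply]
      refine Finset.sum_eq_zero fun k _ => ?_
      rcases lt_or_ge k i with h | h
      · rw [ha i k h, zero_mul]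
      · rw [hb k j (hij.trans_le h), mul_zero]
    · rw [Units.val_mul, Matrix.mul_apply, Finset.sum_eq_single i, ha', hb', mul_one]
      · intro k _ hk
        rcases lt_or_gt_of_ne hk with h | h
        · rw [ha i k h, zero_mul]
        · rw [hb k i h, mul_zero]
      · simp
  inv_mem' := by
    rintro a ⟨ha, ha'⟩
    have hinv : ∀ i j, j < i → a⁻¹.val i j = 0 := by
      have h1 : Matrix.BlockTriangular a.val (id : Fin n → Fin n) := fun i j h => ha i j h
      letI : Invertible a.val := Units.invertible a
      have h2 := Matrix.blockTriangular_inv_of_blockTriangular h1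
      intro i j h
      rw [Matrix.coe_units_inv]
      exact h2 h
    refine ⟨hinv, fun i => ?_⟩
    have h : (a.val * a⁻¹.val) i i = 1 := by
      rw [← Units.val_mul, mul_inv_cancel]; simp
    rw [Matrix.mul_apply, Finset.sum_eq_single i, ha', one_mul] at h
    · exact h
    · intro k _ hk
      rcases lt_or_gt_of_ne hk with h | h
      · rw [ha i k h, zero_mul]
      · rw [hinv k i h, mul_zero]
    · simp

variable {n : ℕ} {K : Type*} [Field K]

/-- The underlying matrix of an element of `U(n, K)`. -/
def mat (g : U n K) : Matrix (Fin n) (Fin n) K := (g : GL (Fin n) K).val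

lemma mat_lower (g : U n K) {i j : Fin n} (h : j < i) : mat g i j = 0 := g.2.1 i j h

lemma mat_diag (g : U n K) (i : Fin n) : mat g i i = 1 := g.2.2 i

lemma mat_mul (g h : U n K) : mat (g * h) = mat g * mat h := rfl

/-- The space `𝔲(n, K)` of upper triangular nilpotent (that is, strictly upper triangular)
`n × n` matrices over `K`. -/
def u (n : ℕ) (K : Type*) [Field K] : Submodule K (Matrix (Fin n) (Fin n) K) where
  carrier := {X | ∀ i j, j ≤ i → X i j = 0}
  zero_mem' := fun _ _ _ => rfl
  add_mem' := by
    intro X Y hX hY i j h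
    rw [Matrix.add_apply, hX i j h, hY i j h, add_zero]
  smul_mem' := by
    intro c X hX i j h
    rw [Matrix.smul_apply, hX i j h, smul_zero]

lemma mat_mul_mem (g : U n K) {X : Matrix (Fin n) (Fin n) K} (hX : X ∈ u n K) :
    mat g * X ∈ u n K := by
  intro i j h
  rw [Matrix.mul_apply]
  refine Finset.sum_eq_zero fun k _ => ?_
  rcases lt_or_ge k i with hk | hk
  · rw [mat_lower g hk, zero_mul]
  · rw [hX k j (h.trans hk), mul_zero]

lemma mul_mat_mem (g : U n K) {X : Matrix (Fin n) (Fin n) K} (hX : X ∈ u n K) :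
    X * mat g ∈ u n K := by
  intro i j h
  rw [Matrix.mul_apply]
  refine Finset.sum_eq_zero fun k _ => ?_
  rcases le_or_gt k i with hk | hk
  · rw [hX i k hk, zero_mul]
  · rw [mat_lower g (h.trans_lt hk), mul_zero]

lemma mat_sub_one_mem (g : U n K) : mat g - 1 ∈ u n K := by
  intro i j h
  rcases h.lt_or_eq with h | rfl
  · rw [Matrix.sub_apply, mat_lower g h, Matrix.one_apply_ne h.ne', sub_zero]
  · rw [Matrix.sub_apply, mat_diag, Matrix.one_apply_eq, sub_self]

/-- The element `g - I` of `𝔲(n, K)`. -/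
def subOne (g : U n K) : u n K := ⟨mat g - 1, mat_sub_one_mem g⟩

/-- Left multiplication `X ↦ g · X` on `𝔲(n, K)`. -/
def lmul (g : U n K) : u n K →ₗ[K] u n K where
  toFun X := ⟨mat g * X.1, mat_mul_mem g X.2⟩
  map_add' X Y := Subtype.ext (mul_add _ _ _)
  map_smul' c X := Subtype.ext (Matrix.mul_smul _ _ _)

/-- Right multiplication `X ↦ X · g` on `𝔲(n, K)`. -/
def rmul (g : U n K) : u n K →ₗ[K] u n K where
  toFun X := ⟨X.1 * mat g, mul_mat_mem g X.2⟩
  map_add' X Y := Subtype.ext (add_mul _ _ _)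
  map_smul' c X := Subtype.ext (Matrix.smul_mul _ _ _)

/-- The adjoint cluster `K(X) = {g · X · g'}`. -/
def adjointCluster (X : u n K) : Set (u n K) :=
  {Y | ∃ g g' : U n K, Y = lmul g (rmul g' X)}

/-- The conjugacy cluster of `g`: the set of all `h` in `U(n, K)` such that `h - I` lies in the
adjoint cluster of `g - I`. -/
def conjugacyCluster (g : U n K) : Set (U n K) :=
  {h | subOne h ∈ adjointCluster (subOne g)}

/-- The left action of `U(n, K)` on `𝔲*(n, K)`: `(g * l)(X) = l(X · g)`. -/
def leftAct (g : U n K) (l : Module.Dual K (u n K)) : Module.Dual K (u n K) :=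
  l ∘ₗ rmul g

/-- The right action of `U(n, K)` on `𝔲*(n, K)`: `(l * g)(X) = l(g · X)`. -/
def rightAct (l : Module.Dual K (u n K)) (g : U n K) : Module.Dual K (u n K) :=
  l ∘ₗ lmul g

/-- The coadjoint cluster `Ψ(l) = {g * l * g'}`. -/
def coadjointCluster (l : Module.Dual K (u n K)) : Set (Module.Dual K (u n K)) :=
  {m | ∃ g g' : U n K, m = leftAct g (rightAct l g')}

/-- The orbit of `l` under the left action. -/
def leftOrbit (l : Module.Dual K (u n K)) : Set (Module.Dual K (u n K)) :=
  {m | ∃ g : U n K, m = leftAct g l}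

/-- The collection of all coadjoint clusters in `𝔲*(n, K)`. -/
def coadjointClusters (n : ℕ) (K : Type*) [Field K] : Set (Set (Module.Dual K (u n K))) :=
  Set.range coadjointCluster

/-- The left regular representation on complex functions on `U(n, K)`: `(g * f)(h) = f(h g)`. -/
def regRep (n : ℕ) (K : Type*) [Field K] : Representation ℂ (U n K) (U n K → ℂ) where
  toFun g := LinearMap.funLeft ℂ ℂ (fun h => h * g)
  map_one' := by
    ext f h
    simp [LinearMap.funLeft_apply]
  map_mul' a b := by
    ext f h
    simp [LinearMap.funLeft_apply, mul_assoc]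

/-- The Fourier basis function `v(l) : g ↦ θ(l(g - I))`. -/
def v (θ : AddChar K ℂ) (l : Module.Dual K (u n K)) : U n K → ℂ :=
  fun g => θ (l (subOne g))

lemma subOne_mul (h g : U n K) : subOne (h * g) = subOne g + rmul g (subOne h) := by
  apply Subtype.ext
  change mat (h * g) - 1 = (mat g - 1) + (mat h - 1) * mat g
  rw [mat_mul, sub_mul, one_mul]
  abel

lemma regRep_v (θ : AddChar K ℂ) (g : U n K) (l : Module.Dual K (u n K)) :
    regRep n K g (v θ l) = v θ l g • v θ (leftAct g l) := by
  funext h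
  change θ (l (subOne (h * g))) = θ (l (subOne g)) * θ (l (rmul g (subOne h)))
  rw [subOne_mul, map_add, AddChar.map_add_eq_mul]

lemma leftAct_leftAct (g h : U n K) (l : Module.Dual K (u n K)) :
    leftAct g (leftAct h l) = leftAct (g * h) l := by
  refine LinearMap.ext fun X => congrArg l (Subtype.ext ?_)
  exact Matrix.mul_assoc _ _ _

/-- The cluster module `V(l)`: the span of all `v(m)`, for `m` in the orbit of `l` under the left
action, as a subrepresentation of the regular representation. -/
def clusterModule (θ : AddChar K ℂ) (l : Module.Dual K (u n K)) :
    Subrepresentation (regRep n K) where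
  toSubmodule := Submodule.span ℂ (v θ '' leftOrbit l)
  apply_mem_toSubmodule g f hf := by
    induction hf using Submodule.span_induction with
    | mem x hx =>
      obtain ⟨m, ⟨h, rfl⟩, rfl⟩ := hx
      rw [regRep_v]
      refine Submodule.smul_mem _ _ (Submodule.subset_span ⟨_, ⟨g * h, ?_⟩, rfl⟩)
      exact leftAct_leftAct g h l
    | zero => rw [map_zero]; exact Submodule.zero_mem _
    | add x y _ _ hx hy => rw [map_add]; exact Submodule.add_mem _ hx hy
    | smul c x _ hx => rw [map_smul]; exact Submodule.smul_mem _ c hx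

/-- The cluster character `χ(l)`: the trace of `U(n, K)` on the cluster module `V(l)`. -/
def clusterCharacter (θ : AddChar K ℂ) (l : Module.Dual K (u n K)) : U n K → ℂ :=
  fun g => LinearMap.trace ℂ _ ((clusterModule θ l).toRepresentation g)

/-- The space of cluster functions: complex functions on `U(n, K)` that are constant on each
conjugacy cluster. -/
def clusterFunctions (n : ℕ) (K : Type*) [Field K] : Submodule ℂ (U n K → ℂ) where
  carrier := {f | ∀ g, ∀ h ∈ conjugacyCluster g, f h = f g}
  zero_mem' := fun _ _ _ => rfl
  add_mem' := by
    intro f f' hf hf' g h hh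
    rw [Pi.add_apply, Pi.add_apply, hf g h hh, hf' g h hh]
  smul_mem' := by
    intro c f hf g h hh
    rw [Pi.smul_apply, Pi.smul_apply, hf g h hh]

instance [Finite K] : Fintype (U n K) := Fintype.ofFinite _

/-- The Hermitian inner product `⟨f, f'⟩ = |U|⁻¹ ∑ g, f(g) * conj (f'(g))` on complex functions
on `U(n, K)`, for `K` finite. -/
def innerProd [Finite K] (f f' : U n K → ℂ) : ℂ :=
  (Fintype.card (U n K) : ℂ)⁻¹ * ∑ g, f g * (starRingEnd ℂ) (f' g)

end Cluster

end

/-!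
The functions `v θ l`, for `l` in the dual of `𝔲`, are the characters of the additive group of `𝔲`
pulled back along the bijection `g ↦ g - I`; they form an orthogonal basis of the functions on
`U` (`innerProd_v`, `linearIndependent_v`, `span_range_v`).

Everything rests on one formula, `clusterCharacter_eq`:
`χ(l) = |U l| / |U|² • ∑ h k, v (h * l * k)`.
In the basis `v m`, `m ∈ U l`, of the cluster module each `g` acts by a monomial matrix, so its
trace is the sum of `v m g` over those `m ∈ U l` that `g` fixes. The condition `g * m = m` says that
`m` vanishes on `𝔲 (g - I)`, and its indicator function, times `v m g`, is the average over `k`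
of `v (m * k) g`. The sum over the orbit is then replaced by an average over the group.

The double sum over `U × U` depends only on the coadjoint cluster of `l`, is a cluster function, and
lies in the span of the `v m` with `m` in that cluster. Distinct clusters being disjoint,
orthogonality follows, and with it linear independence, as `χ(l)(1) = |U l| ≠ 0`. Finally,
averaging the expansion of a cluster function in the basis `v l` over `U × U` expresses the
function through the cluster characters.
-/

namespace Cluster

open Matrix

variable {n : ℕ} {F : Type*} [Field F]

/-! ### The bijection `g ↦ g - I` and the two actions on the dual -/

lemma subOne_bijective : Function.Bijective (subOne : U n F → u n F) := by
  constructor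
  · intro g h hgh
    have h1 : mat g - 1 = mat h - 1 := congrArg Subtype.val hgh
    exact Subtype.ext (Units.ext (sub_left_injective h1))
  · intro X
    have hlow : ∀ i j, j < i → (1 + X.1) i j = 0 := fun i j h => by
      rw [Matrix.add_apply, Matrix.one_apply_ne h.ne', X.2 i j h.le, add_zero]
    have hdiag : ∀ i, (1 + X.1) i i = 1 := fun i => by
      rw [Matrix.add_apply, Matrix.one_apply_eq, X.2 i i le_rfl, add_zero]
    have hdet : (1 + X.1).det ≠ 0 := by
      rw [Matrix.det_of_isUpperTriangular (fun i j h => hlow i j h)]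
      simp only [hdiag, Finset.prod_const_one]
      exact one_ne_zero
    refine ⟨⟨Matrix.GeneralLinearGroup.mkOfDetNeZero _ hdet, hlow, hdiag⟩, Subtype.ext ?_⟩
    exact add_sub_cancel_left 1 X.1

/-- The bijection `g ↦ g - I` from `U(n, F)` to `𝔲(n, F)`. -/
noncomputable def subOneEquiv : U n F ≃ u n F := Equiv.ofBijective subOne subOne_bijective

lemma subOne_subOneEquiv_symm (X : u n F) : subOne (subOneEquiv.symm X) = X :=
  subOneEquiv.apply_symm_apply X

lemma lmul_lmul (g h : U n F) (X : u n F) : lmul g (lmul h X) = lmul (g * h) X :=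
  Subtype.ext (Matrix.mul_assoc _ _ _).symm

lemma rmul_rmul (g h : U n F) (X : u n F) : rmul g (rmul h X) = rmul (h * g) X :=
  Subtype.ext (Matrix.mul_assoc _ _ _)

lemma lmul_rmul (g h : U n F) (X : u n F) : lmul g (rmul h X) = rmul h (lmul g X) :=
  Subtype.ext (Matrix.mul_assoc _ _ _).symm

lemma lmul_one (X : u n F) : lmul 1 X = X := Subtype.ext (Matrix.one_mul _)

lemma rmul_one (X : u n F) : rmul 1 X = X := Subtype.ext (Matrix.mul_one _)

lemma leftAct_one (l : Module.Dual F (u n F)) : leftAct 1 l = l :=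
  LinearMap.ext fun X => congrArg l (rmul_one X)

lemma rightAct_one (l : Module.Dual F (u n F)) : rightAct l 1 = l :=
  LinearMap.ext fun X => congrArg l (lmul_one X)

lemma rightAct_rightAct (l : Module.Dual F (u n F)) (g h : U n F) :
    rightAct (rightAct l g) h = rightAct l (g * h) :=
  LinearMap.ext fun X => congrArg l (lmul_lmul g h X)

lemma rightAct_leftAct (g h : U n F) (l : Module.Dual F (u n F)) :
    rightAct (leftAct g l) h = leftAct g (rightAct l h) :=
  LinearMap.ext fun X => congrArg l (lmul_rmul h g X).symm

lemma leftAct_injective (g : U n F) :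
    Function.Injective (leftAct g : Module.Dual F (u n F) → Module.Dual F (u n F)) :=
  Function.LeftInverse.injective (g := leftAct g⁻¹) fun l => by
    rw [leftAct_leftAct, inv_mul_cancel, leftAct_one]

lemma rightAct_injective (g : U n F) :
    Function.Injective fun l : Module.Dual F (u n F) => rightAct l g :=
  Function.LeftInverse.injective (g := fun l => rightAct l g⁻¹) fun l => by
    simp only [rightAct_rightAct, mul_inv_cancel, rightAct_one]

lemma self_mem_leftOrbit (l : Module.Dual F (u n F)) : l ∈ leftOrbit l :=
  ⟨1, (leftAct_one l).symm⟩

lemma leftAct_mem_leftOrbit (g : U n F) {l m : Module.Dual F (u n F)} (hm : m ∈ leftOrbit l) :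
    leftAct g m ∈ leftOrbit l := by
  obtain ⟨h, rfl⟩ := hm
  exact ⟨g * h, leftAct_leftAct g h l⟩

lemma leftOrbit_leftAct (g : U n F) (l : Module.Dual F (u n F)) :
    leftOrbit (leftAct g l) = leftOrbit l := by
  ext m
  constructor
  · rintro ⟨h, rfl⟩
    exact ⟨h * g, leftAct_leftAct h g l⟩
  · rintro ⟨h, rfl⟩
    exact ⟨h * g⁻¹, by rw [leftAct_leftAct, inv_mul_cancel_right]⟩

lemma leftOrbit_rightAct (l : Module.Dual F (u n F)) (g : U n F) :
    leftOrbit (rightAct l g) = (fun m => rightAct m g) '' leftOrbit l := by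
  ext m
  constructor
  · rintro ⟨h, rfl⟩
    exact ⟨_, ⟨h, rfl⟩, rightAct_leftAct h g l⟩
  · rintro ⟨_, ⟨h, rfl⟩, rfl⟩
    exact ⟨h, rightAct_leftAct h g l⟩

lemma self_mem_coadjointCluster (l : Module.Dual F (u n F)) : l ∈ coadjointCluster l :=
  ⟨1, 1, by rw [rightAct_one, leftAct_one]⟩

lemma coadjointCluster_eq_of_mem {l m : Module.Dual F (u n F)} (hm : m ∈ coadjointCluster l) :
    coadjointCluster m = coadjointCluster l := by
  obtain ⟨a, b, rfl⟩ := hm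
  ext p
  constructor
  · rintro ⟨g, h, rfl⟩
    exact ⟨g * a, b * h, by rw [rightAct_leftAct, leftAct_leftAct, rightAct_rightAct]⟩
  · rintro ⟨g, h, rfl⟩
    exact ⟨g * a⁻¹, b⁻¹ * h, by
      rw [rightAct_leftAct, leftAct_leftAct, rightAct_rightAct, inv_mul_cancel_right,
        mul_inv_cancel_left]⟩

lemma v_leftAct_rightAct (θ : AddChar F ℂ) (l : Module.Dual F (u n F)) (h k g : U n F) :
    v θ (leftAct h (rightAct l k)) g = θ (l (lmul k (rmul h (subOne g)))) := rfl

lemma v_one (θ : AddChar F ℂ) (l : Module.Dual F (u n F)) : v θ l 1 = 1 := by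
  have h : subOne (1 : U n F) = 0 := Subtype.ext (sub_self _)
  rw [v, h, map_zero, AddChar.map_zero_eq_one]

/-! ### Fourier analysis on `𝔲` -/

/-- Composition of `θ` with the linear form `l`, as an additive character of `𝔲`. -/
def dualChar (θ : AddChar F ℂ) (l : Module.Dual F (u n F)) : AddChar (u n F) ℂ :=
  θ.compAddMonoidHom l.toAddMonoidHom

lemma dualChar_apply (θ : AddChar F ℂ) (l : Module.Dual F (u n F)) (X : u n F) :
    dualChar θ l X = θ (l X) := rfl

/-- The image of a non-zero linear form is the whole field, on which `θ` is non-trivial. -/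
lemma dualChar_eq_one_iff {θ : AddChar F ℂ} (hθ : θ ≠ 1) (l : Module.Dual F (u n F)) :
    dualChar θ l = 1 ↔ l = 0 := by
  constructor
  · intro h
    by_contra hl
    obtain ⟨a, ha⟩ := AddChar.ne_one_iff.1 hθ
    obtain ⟨X, rfl⟩ := LinearMap.surjective hl a
    exact ha (DFunLike.congr_fun h X)
  · rintro rfl
    ext X
    simp [dualChar_apply]

lemma dualChar_injective {θ : AddChar F ℂ} (hθ : θ ≠ 1) :
    Function.Injective (dualChar θ : Module.Dual F (u n F) → AddChar (u n F) ℂ) := by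
  intro l m h
  rw [← sub_eq_zero, ← dualChar_eq_one_iff hθ]
  ext X
  have hX : θ (l X) = θ (m X) := DFunLike.congr_fun h X
  rw [dualChar_apply, LinearMap.sub_apply, sub_eq_add_neg, AddChar.map_add_eq_mul, hX,
    ← AddChar.map_add_eq_mul, add_neg_cancel, AddChar.map_zero_eq_one, AddChar.one_apply]

variable [Finite F]

instance : Finite (Module.Dual F (u n F)) := Module.finite_of_finite F

lemma linearIndependent_v {θ : AddChar F ℂ} (hθ : θ ≠ 1) :
    LinearIndependent ℂ (v θ : Module.Dual F (u n F) → U n F → ℂ) := by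
  have h1 := (AddChar.linearIndependent (u n F) ℂ).comp _ (dualChar_injective (n := n) hθ)
  exact h1.map' (LinearMap.funLeft ℂ ℂ (subOne : U n F → u n F))
    (LinearMap.ker_eq_bot.2
      (LinearMap.funLeft_injective_of_surjective _ _ _ subOne_bijective.2))

lemma sum_dualChar [Fintype (u n F)] {θ : AddChar F ℂ} (hθ : θ ≠ 1)
    (l : Module.Dual F (u n F)) [Decidable (l = 0)] :
    ∑ X, θ (l X) = if l = 0 then (Fintype.card (U n F) : ℂ) else 0 := by
  classical
  change ∑ X, dualChar θ l X = _
  rw [AddChar.sum_eq_ite, Fintype.card_congr (subOneEquiv (n := n) (F := F)),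
    ← AddChar.one_eq_zero]
  simp only [dualChar_eq_one_iff hθ]

lemma sum_subOne [Fintype (u n F)] (f : u n F → ℂ) : ∑ g : U n F, f (subOne g) = ∑ X, f X :=
  Equiv.sum_comp subOneEquiv f

lemma innerProd_v {θ : AddChar F ℂ} (hθ : θ ≠ 1) {l m : Module.Dual F (u n F)} (hlm : l ≠ m) :
    innerProd (v θ l) (v θ m) = 0 := by
  classical
  let _ : Fintype (u n F) := Fintype.ofFinite _
  have h : ∀ g : U n F, v θ l g * (starRingEnd ℂ) (v θ m g) = θ ((l - m) (subOne g)) := by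
    intro g
    rw [v, v, ← AddChar.map_neg_eq_conj, ← AddChar.map_add_eq_mul, LinearMap.sub_apply,
      sub_eq_add_neg]
  rw [innerProd, Finset.sum_congr rfl fun g _ => h g,
    sum_subOne fun X => θ ((l - m) X), sum_dualChar hθ, if_neg (sub_ne_zero.2 hlm), mul_zero]

lemma span_range_v {θ : AddChar F ℂ} (hθ : θ ≠ 1) :
    Submodule.span ℂ (Set.range (v θ : Module.Dual F (u n F) → U n F → ℂ)) = ⊤ := by
  let _ : Fintype (Module.Dual F (u n F)) := Fintype.ofFinite _
  refine (linearIndependent_v hθ).span_eq_top_of_card_eq_finrank' ?_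
  rw [Module.finrank_fintype_fun_eq_card, ← Nat.card_eq_fintype_card,
    ← Nat.card_eq_fintype_card, Nat.card_congr (subOneEquiv (n := n) (F := F))]
  exact Nat.card_congr (Module.finBasis F (u n F)).toDualEquiv.symm.toEquiv

/-! ### The formula for the cluster characters -/

/-- The sum of `v θ (h * l * k)` over all pairs `(h, k)` in `U × U`. -/
noncomputable def clusterSum (θ : AddChar F ℂ) (l : Module.Dual F (u n F)) : U n F → ℂ :=
  ∑ h : U n F, ∑ k : U n F, v θ (leftAct h (rightAct l k))

lemma clusterSum_apply (θ : AddChar F ℂ) (l : Module.Dual F (u n F)) (g : U n F) :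
    clusterSum θ l g = ∑ h : U n F, ∑ k : U n F, θ (l (lmul k (rmul h (subOne g)))) := by
  simp only [clusterSum, Finset.sum_apply, v_leftAct_rightAct]

lemma clusterSum_leftAct_rightAct (θ : AddChar F ℂ) (l : Module.Dual F (u n F)) (a b : U n F) :
    clusterSum θ (leftAct a (rightAct l b)) = clusterSum θ l := by
  unfold clusterSum
  simp only [rightAct_leftAct, leftAct_leftAct, rightAct_rightAct]
  refine (Equiv.sum_comp (Equiv.mulRight a)
    fun h => ∑ k : U n F, v θ (leftAct h (rightAct l (b * k)))).trans ?_
  exact Finset.sum_congr rfl fun h _ =>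
    Equiv.sum_comp (Equiv.mulLeft b) fun k => v θ (leftAct h (rightAct l k))

lemma clusterSum_mem_clusterFunctions (θ : AddChar F ℂ) (l : Module.Dual F (u n F)) :
    clusterSum θ l ∈ clusterFunctions n F := by
  rintro g h ⟨a, b, hab⟩
  simp only [clusterSum_apply, hab, ← lmul_rmul, rmul_rmul, lmul_lmul]
  refine (Equiv.sum_comp (Equiv.mulLeft b)
    fun h => ∑ k : U n F, θ (l (lmul (k * a) (rmul h (subOne g))))).trans ?_
  exact Finset.sum_congr rfl fun h _ =>
    Equiv.sum_comp (Equiv.mulRight a) fun k => θ (l (lmul k (rmul h (subOne g))))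

/-- The matrix of `g` in the basis `v θ m`, `m ∈ U l`, of the cluster module is monomial; only the
fixed points of `g` contribute to its trace. -/
lemma clusterCharacter_eq_sum_fixed {θ : AddChar F ℂ} (hθ : θ ≠ 1) (l : Module.Dual F (u n F))
    [Fintype (leftOrbit l)] [DecidableEq (Module.Dual F (u n F))] (g : U n F) :
    clusterCharacter θ l g =
      ∑ m : leftOrbit l, if leftAct g m.1 = m.1 then v θ m.1 g else 0 := by
  have hli : LinearIndependent ℂ fun m : leftOrbit l => v θ m.1 :=
    (linearIndependent_v hθ).comp _ Subtype.val_injective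
  let b : Module.Basis (leftOrbit l) ℂ (clusterModule θ l).toSubmodule :=
    (Module.Basis.span hli).map (LinearEquiv.ofEq _ _
      (congrArg (Submodule.span ℂ) (Set.image_eq_range (v θ) (leftOrbit l)).symm))
  have hb : ∀ m, (b m : U n F → ℂ) = v θ m.1 := fun m =>
    congrArg Subtype.val (Module.Basis.span_apply hli m)
  have hact : ∀ m, (clusterModule θ l).toRepresentation g (b m) =
      v θ m.1 g • b ⟨leftAct g m.1, leftAct_mem_leftOrbit g m.2⟩ := by
    intro m
    apply Subtype.ext
    change regRep n F g (b m : U n F → ℂ) = v θ m.1 g • (b _ : U n F → ℂ)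
    rw [hb, hb, regRep_v]
  change LinearMap.trace ℂ (clusterModule θ l).toSubmodule
    ((clusterModule θ l).toRepresentation g) = _
  rw [LinearMap.trace_eq_matrix_trace ℂ b, Matrix.trace]
  refine Finset.sum_congr rfl fun m _ => ?_
  rw [Matrix.diag_apply, LinearMap.toMatrix_apply, hact, map_smul, Module.Basis.repr_self,
    Finsupp.smul_apply, Finsupp.single_apply, smul_eq_mul, mul_ite, mul_one, mul_zero]
  simp only [Subtype.ext_iff]

/-- Writing `k = I + X`, the summand is `θ (m (g - I)) * θ (m (X * (g - I)))`, and the sum over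
`X` of the second factor vanishes unless `m` is zero on `𝔲 * (g - I)`, that is, `g * m = m`. -/
lemma sum_v_rightAct {θ : AddChar F ℂ} (hθ : θ ≠ 1) (m : Module.Dual F (u n F))
    (g : U n F) [Decidable (leftAct g m = m)] :
    ∑ k : U n F, v θ (rightAct m k) g =
      Fintype.card (U n F) * if leftAct g m = m then v θ m g else 0 := by
  classical
  let _ : Fintype (u n F) := Fintype.ofFinite _
  have h : ∀ k : U n F, v θ (rightAct m k) g =
      v θ m g * θ ((leftAct g m - m) (subOne k)) := by
    intro k
    change θ (m (lmul k (subOne g))) = θ (m (subOne g)) * θ (m (rmul g (subOne k)) - m (subOne k))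
    rw [← AddChar.map_add_eq_mul, ← map_sub, ← map_add]
    refine congrArg (fun X => θ (m X)) (Subtype.ext ?_)
    change mat k * (mat g - 1) = (mat g - 1) + ((mat k - 1) * mat g - (mat k - 1))
    noncomm_ring
  rw [Finset.sum_congr rfl fun k _ => h k, ← Finset.mul_sum,
    sum_subOne fun X => θ ((leftAct g m - m) X), sum_dualChar hθ]
  simp only [sub_eq_zero]
  split_ifs
  · ring
  · ring

/-- Both sides are obtained from `∑ m, ∑ h, f (h * m)` by summing over one of the variables
first. -/
lemma card_mul_sum_leftOrbit (l : Module.Dual F (u n F)) [Fintype (leftOrbit l)]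
    (f : Module.Dual F (u n F) → ℂ) :
    Fintype.card (U n F) * ∑ m : leftOrbit l, f m.1 =
      Fintype.card (leftOrbit l) * ∑ h : U n F, f (leftAct h l) := by
  have h1 : ∀ h : U n F, ∑ m : leftOrbit l, f (leftAct h m.1) = ∑ m : leftOrbit l, f m.1 := by
    intro h
    let e : leftOrbit l → leftOrbit l := fun m => ⟨leftAct h m.1, leftAct_mem_leftOrbit h m.2⟩
    have he : Function.Injective e := fun a b hab =>
      Subtype.ext (leftAct_injective h (congrArg Subtype.val hab))
    exact (Finite.injective_iff_bijective.1 he).sum_comp fun m : leftOrbit l => f m.1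
  have h2 : ∀ m : leftOrbit l, ∑ h : U n F, f (leftAct h m.1) = ∑ h : U n F, f (leftAct h l) := by
    rintro ⟨_, a, rfl⟩
    simp only [leftAct_leftAct]
    exact Equiv.sum_comp (Equiv.mulRight a) fun h => f (leftAct h l)
  have h3 := Finset.sum_comm (s := (Finset.univ : Finset (U n F)))
    (t := (Finset.univ : Finset (leftOrbit l))) (f := fun h m => f (leftAct h m.1))
  simpa only [h1, h2, Finset.sum_const, Finset.card_univ, nsmul_eq_mul] using h3

lemma clusterCharacter_eq {θ : AddChar F ℂ} (hθ : θ ≠ 1) (l : Module.Dual F (u n F)) :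
    clusterCharacter θ l =
      ((Nat.card (leftOrbit l) : ℂ) / (Fintype.card (U n F) : ℂ) ^ 2) • clusterSum θ l := by
  classical
  let _ : Fintype (leftOrbit l) := Fintype.ofFinite _
  have hU : (Fintype.card (U n F) : ℂ) ≠ 0 := Nat.cast_ne_zero.2 Fintype.card_ne_zero
  funext g
  rw [Pi.smul_apply, smul_eq_mul, div_mul_eq_mul_div, eq_div_iff (pow_ne_zero 2 hU),
    Nat.card_eq_fintype_card]
  have h := card_mul_sum_leftOrbit l fun m => ∑ k : U n F, v θ (rightAct m k) g
  simp only [sum_v_rightAct hθ, ← Finset.mul_sum] at h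
  rw [← clusterCharacter_eq_sum_fixed hθ] at h
  have h' : clusterSum θ l g = ∑ k : U n F, ∑ h : U n F, v θ (rightAct (leftAct k l) h) g := by
    simp only [clusterSum, Finset.sum_apply, rightAct_leftAct]
  simp only [sum_v_rightAct hθ, ← Finset.mul_sum] at h'
  rw [h', ← h]
  ring

/-! ### Consequences for cluster characters -/

lemma natCard_leftOrbit_ne_zero (l : Module.Dual F (u n F)) :
    (Nat.card (leftOrbit l) : ℂ) ≠ 0 := by
  have : Nonempty (leftOrbit l) := ⟨⟨l, self_mem_leftOrbit l⟩⟩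
  exact Nat.cast_ne_zero.2 Nat.card_pos.ne'

lemma clusterCharacter_eq_of_mem {θ : AddChar F ℂ} (hθ : θ ≠ 1) {l m : Module.Dual F (u n F)}
    (hm : m ∈ coadjointCluster l) : clusterCharacter θ m = clusterCharacter θ l := by
  obtain ⟨a, b, rfl⟩ := hm
  rw [clusterCharacter_eq hθ, clusterCharacter_eq hθ, clusterSum_leftAct_rightAct,
    leftOrbit_leftAct, leftOrbit_rightAct, Nat.card_image_of_injective (rightAct_injective b)]

lemma clusterCharacter_mem_clusterFunctions {θ : AddChar F ℂ} (hθ : θ ≠ 1)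
    (l : Module.Dual F (u n F)) : clusterCharacter θ l ∈ clusterFunctions n F := by
  rw [clusterCharacter_eq hθ]
  exact Submodule.smul_mem _ _ (clusterSum_mem_clusterFunctions θ l)

lemma clusterCharacter_one {θ : AddChar F ℂ} (hθ : θ ≠ 1) (l : Module.Dual F (u n F)) :
    clusterCharacter θ l 1 = Nat.card (leftOrbit l) := by
  have hU : (Fintype.card (U n F) : ℂ) ≠ 0 := Nat.cast_ne_zero.2 Fintype.card_ne_zero
  rw [clusterCharacter_eq hθ, Pi.smul_apply, clusterSum]
  simp only [Finset.sum_apply, v_one, Finset.sum_const, Finset.card_univ, nsmul_eq_mul,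
    mul_one, smul_eq_mul]
  field_simp

/-- `innerProd` as a sesquilinear form, conjugate-linear in the second argument. -/
noncomputable def innerProdHom (n : ℕ) (F : Type*) [Field F] [Finite F] :
    (U n F → ℂ) →ₗ[ℂ] (U n F → ℂ) →ₛₗ[starRingEnd ℂ] ℂ :=
  LinearMap.mk₂'ₛₗ (RingHom.id ℂ) (starRingEnd ℂ) innerProd
    (fun f f' k => by
      simp only [innerProd, Pi.add_apply, add_mul, Finset.sum_add_distrib, mul_add])
    (fun c f k => by
      simp only [innerProd, Pi.smul_apply, smul_eq_mul, mul_assoc, ← Finset.mul_sum,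
        RingHom.id_apply]
      ring)
    (fun f k k' => by
      simp only [innerProd, Pi.add_apply, map_add, mul_add, Finset.sum_add_distrib])
    (fun c f k => by
      simp only [innerProd, Pi.smul_apply, smul_eq_mul, map_mul, mul_left_comm (f _),
        ← Finset.mul_sum]
      ring)

lemma innerProdHom_apply (f f' : U n F → ℂ) : innerProdHom n F f f' = innerProd f f' := rfl

lemma innerProd_clusterCharacter {θ : AddChar F ℂ} (hθ : θ ≠ 1) {l m : Module.Dual F (u n F)}
    (hlm : coadjointCluster l ≠ coadjointCluster m) :
    innerProd (clusterCharacter θ l) (clusterCharacter θ m) = 0 := by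
  have key : ∀ h k h' k' : U n F,
      innerProd (v θ (leftAct h (rightAct l k))) (v θ (leftAct h' (rightAct m k'))) = 0 := by
    intro h k h' k'
    refine innerProd_v hθ fun heq => hlm ?_
    rw [← coadjointCluster_eq_of_mem ⟨h, k, rfl⟩, heq,
      coadjointCluster_eq_of_mem ⟨h', k', rfl⟩]
  rw [clusterCharacter_eq hθ, clusterCharacter_eq hθ, ← innerProdHom_apply]
  simp only [clusterSum, map_smul, map_smulₛₗ, map_sum, LinearMap.smul_apply, LinearMap.sum_apply,
    innerProdHom_apply, key, Finset.sum_const_zero, smul_zero]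

/-- Averaging over the pairs `(h, k)`, by `g ↦ I + k (g - I) h`: this fixes cluster functions and
maps `v θ l` to a multiple of `χ(l)`. -/
noncomputable def average (n : ℕ) (F : Type*) [Field F] [Finite F] :
    (U n F → ℂ) →ₗ[ℂ] (U n F → ℂ) where
  toFun f g := ((Fintype.card (U n F) : ℂ) ^ 2)⁻¹ *
    ∑ h : U n F, ∑ k : U n F, f (subOneEquiv.symm (lmul k (rmul h (subOne g))))
  map_add' f f' := by
    funext g
    simp only [Pi.add_apply, Finset.sum_add_distrib, mul_add]
  map_smul' c f := by
    funext g
    simp only [Pi.smul_apply, smul_eq_mul, ← Finset.mul_sum, RingHom.id_apply]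
    ring

lemma average_of_mem_clusterFunctions {f : U n F → ℂ} (hf : f ∈ clusterFunctions n F) :
    average n F f = f := by
  have hU : (Fintype.card (U n F) : ℂ) ≠ 0 := Nat.cast_ne_zero.2 Fintype.card_ne_zero
  funext g
  have h : ∀ h k : U n F, f (subOneEquiv.symm (lmul k (rmul h (subOne g)))) = f g :=
    fun h k => hf g _ ⟨k, h, subOne_subOneEquiv_symm _⟩
  change ((Fintype.card (U n F) : ℂ) ^ 2)⁻¹ * ∑ h : U n F, ∑ k : U n F,
    f (subOneEquiv.symm (lmul k (rmul h (subOne g)))) = _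
  simp only [h, Finset.sum_const, Finset.card_univ, nsmul_eq_mul]
  field_simp

lemma average_v {θ : AddChar F ℂ} (hθ : θ ≠ 1) (l : Module.Dual F (u n F)) :
    average n F (v θ l) = (Nat.card (leftOrbit l) : ℂ)⁻¹ • clusterCharacter θ l := by
  have h1 : average n F (v θ l) = ((Fintype.card (U n F) : ℂ) ^ 2)⁻¹ • clusterSum θ l := by
    funext g
    rw [Pi.smul_apply, clusterSum_apply, smul_eq_mul]
    change ((Fintype.card (U n F) : ℂ) ^ 2)⁻¹ * ∑ h : U n F, ∑ k : U n F,
      v θ l (subOneEquiv.symm (lmul k (rmul h (subOne g)))) = _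
    simp only [v, subOne_subOneEquiv_symm]
  rw [h1, clusterCharacter_eq hθ, smul_smul, div_eq_mul_inv,
    inv_mul_cancel_left₀ (natCard_leftOrbit_ne_zero l)]

lemma mem_span_clusterCharacter {θ : AddChar F ℂ} (hθ : θ ≠ 1) {f : U n F → ℂ}
    (hf : f ∈ clusterFunctions n F) :
    f ∈ Submodule.span ℂ (Set.range (clusterCharacter (n := n) θ)) := by
  rw [← average_of_mem_clusterFunctions hf]
  have hle : Submodule.span ℂ (Set.range (v θ)) ≤
      (Submodule.span ℂ (Set.range (clusterCharacter (n := n) θ))).comap (average n F) := by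
    rw [Submodule.span_le]
    rintro _ ⟨l, rfl⟩
    change average n F (v θ l) ∈ Submodule.span ℂ (Set.range (clusterCharacter (n := n) θ))
    rw [average_v hθ]
    exact Submodule.smul_mem _ _ (Submodule.subset_span ⟨l, rfl⟩)
  rw [span_range_v hθ] at hle
  exact hle Submodule.mem_top

/-- The cluster character of a coadjoint cluster, as a cluster function; it is computed from a
chosen element of the cluster. -/
noncomputable def characterOfCluster {θ : AddChar F ℂ} (hθ : θ ≠ 1)
    (Ψ : coadjointClusters n F) : clusterFunctions n F :=
  ⟨clusterCharacter θ Ψ.2.choose, clusterCharacter_mem_clusterFunctions hθ _⟩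

lemma characterOfCluster_coadjointCluster {θ : AddChar F ℂ} (hθ : θ ≠ 1)
    (l : Module.Dual F (u n F)) :
    (characterOfCluster hθ ⟨coadjointCluster l, Set.mem_range_self l⟩ : U n F → ℂ) =
      clusterCharacter θ l := by
  refine clusterCharacter_eq_of_mem hθ ?_
  have h := (Set.mem_range_self (f := coadjointCluster) l).choose_spec
  exact h.subset (self_mem_coadjointCluster _)

lemma innerProd_characterOfCluster {θ : AddChar F ℂ} (hθ : θ ≠ 1)
    {Ψ Ψ' : coadjointClusters n F} (h : Ψ ≠ Ψ') :
    innerProd (characterOfCluster hθ Ψ : U n F → ℂ) (characterOfCluster hθ Ψ') = 0 := by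
  refine innerProd_clusterCharacter hθ fun heq => h (Subtype.ext ?_)
  rwa [Ψ.2.choose_spec, Ψ'.2.choose_spec] at heq

lemma eq_zero_of_innerProd_self {f : U n F → ℂ} (hf : innerProd f f = 0) : f = 0 := by
  have hU : (Fintype.card (U n F) : ℂ) ≠ 0 := Nat.cast_ne_zero.2 Fintype.card_ne_zero
  have h1 := (mul_eq_zero.1 hf).resolve_left (inv_ne_zero hU)
  simp only [Complex.mul_conj, ← Complex.ofReal_sum, Complex.ofReal_eq_zero] at h1
  funext g
  rw [Finset.sum_eq_zero_iff_of_nonneg fun g _ => Complex.normSq_nonneg _] at h1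
  exact Complex.normSq_eq_zero.1 (h1 g (Finset.mem_univ g))

lemma linearIndependent_characterOfCluster {θ : AddChar F ℂ} (hθ : θ ≠ 1) :
    LinearIndependent ℂ (characterOfCluster (n := n) hθ) := by
  rw [linearIndependent_iff']
  intro s c hc Ψ hΨ
  have h0 : (∑ Φ ∈ s, c Φ • (characterOfCluster hθ Φ : U n F → ℂ)) = 0 := by
    simpa using congrArg Subtype.val hc
  have h1 := congrArg (fun f => innerProdHom n F f (characterOfCluster hθ Ψ)) h0
  simp only [map_sum, map_smul, LinearMap.sum_apply, LinearMap.smul_apply, map_zero,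
    LinearMap.zero_apply, innerProdHom_apply] at h1
  rw [Finset.sum_eq_single_of_mem Ψ hΨ fun Φ _ hΦ => by
    rw [innerProd_characterOfCluster hθ hΦ, smul_zero]] at h1
  refine (smul_eq_zero.1 h1).resolve_right fun h2 => ?_
  have h3 := congrFun (eq_zero_of_innerProd_self h2) 1
  exact natCard_leftOrbit_ne_zero _ ((clusterCharacter_one hθ Ψ.2.choose).symm.trans h3)

lemma span_characterOfCluster {θ : AddChar F ℂ} (hθ : θ ≠ 1) :
    ⊤ ≤ Submodule.span ℂ (Set.range (characterOfCluster (n := n) hθ)) := by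
  rintro ⟨f, hf⟩ -
  have hrange : Set.range (clusterCharacter (n := n) θ) =
      (clusterFunctions n F).subtype '' Set.range (characterOfCluster (n := n) hθ) := by
    ext x
    constructor
    · rintro ⟨l, rfl⟩
      exact ⟨_, ⟨_, rfl⟩, characterOfCluster_coadjointCluster hθ l⟩
    · rintro ⟨_, ⟨Ψ, rfl⟩, rfl⟩
      exact ⟨_, rfl⟩
  have h := mem_span_clusterCharacter hθ hf
  rw [hrange, ← Submodule.map_span] at h
  obtain ⟨y, hy, hyf⟩ := h
  rwa [← (Subtype.ext hyf : y = ⟨f, hf⟩)]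

end Cluster

theorem corollary3p8 (n : ℕ) (F : Type*) [Field F] [Finite F] (θ : AddChar F ℂ) (hθ : θ ≠ 1) :
    ∃ b : Module.Basis (Cluster.coadjointClusters n F) ℂ (Cluster.clusterFunctions n F),
      (∀ l : Module.Dual F (Cluster.u n F),
        (b ⟨Cluster.coadjointCluster l, Set.mem_range_self l⟩ : Cluster.U n F → ℂ) =
          Cluster.clusterCharacter θ l) ∧
      ∀ Ψ Ψ' : Cluster.coadjointClusters n F, Ψ ≠ Ψ' →
        Cluster.innerProd (b Ψ : Cluster.U n F → ℂ) (b Ψ' : Cluster.U n F → ℂ) = 0 := by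
  refine ⟨Module.Basis.mk (Cluster.linearIndependent_characterOfCluster hθ)
    (Cluster.span_characterOfCluster hθ), fun l => ?_, fun Ψ Ψ' h => ?_⟩
  · rw [Module.Basis.mk_apply]
    exact Cluster.characterOfCluster_coadjointCluster hθ l
  · rw [Module.Basis.mk_apply, Module.Basis.mk_apply]
    exact Cluster.innerProd_characterOfCluster hθ h
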